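/- \textbf{Setting.} For $\sigma\in\mathbb R$ let $\Pi_{\sigma}=\{z\in\mathbb C:\operatorname{Re}z>\sigma\}$. Let $\sigma_0<1$ be real, let $m\ge 0$ be an integer, and let $L(s)=\sum_{n\ge1}a_nn^{-s}$ be a Dirichlet series such that (a) $a_n=O_\varepsilon(n^{\varepsilon})$ for every $\varepsilon>0$ (so the series converges absolutely for $\operatorname{Re}s>1$); (b) $L$ has a meromorphic continuation to $\Pi_{\sigma_0}$, again denoted by $L$, which is analytic on $\Pi_{\sigma_0}\setminus\{1\}$ and has a pole of order exactly $m$ at $s=1$ (for $m=0$ this means that $L$ is analytic at $1$); (c) $s\mapsto(s-1)^{m}L(s)$ is of finite order in $\Pi_{\sigma_0}$, i.e. there are real numbers $A,R$ with $|(s-1)^mL(s)|\le\exp(|s|^{A})$ for all $s\in\Pi_{\sigma_0}$ with $|s|\ge R$. Let $\varphi:[0,\infty)\to\mathbb C$ be Lebesgue measurable, supported on $[0,1]$, locally bounded on $(0,1)$, with $\varphi(x)=O(x^{-\sigma_0})$ as $x\to0^+$ and $\varphi(x)=O((1-x)^{-\sigma_1})$ as $x\to1^-$ for some $\sigma_1<1/2$.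 Let $\widehat\varphi(s)=\int_0^{\infty}\varphi(t)t^{s-1}\,dt$ for $s\in\Pi_{\sigma_0}$, and for $u>0$ put $$\psi(u)=\operatorname{Res}_{s=1}\bigl(L(s)\widehat\varphi(s)u^{s}\bigr)-\sum_{1\le n<u}a_n\,\varphi\!\left(\frac nu\right).$$ Let $r>\sigma_0$ be a real number such that $\psi\in L^2\bigl((1,\infty),\frac{du}{u^{1+2r}}\bigr)$. An $m$-admissible sequence is a pair $A=(\alpha,c)$ with $\alpha\in(0,1]^{\ell}$ and $c\in\mathbb C^{\ell}$ for some $\ell\ge1$, such that $\sum_{j=1}^{\ell}c_j\alpha_j(\log\alpha_j)^k=0$ for all integers $0\le k\le m-1$. For such $A$ put $$f_{A,r}(t)=t^{r-\sigma_0}\sum_{j=1}^{\ell}c_j\,\psi\!\left(\frac{\alpha_j}{t}\right)\qquad(t>0).$$ Let $L^2_*=L^2_*\bigl((0,1),\frac{dt}{t^{1-2\sigma_0}}\bigr)$ be the space of functions in $L^2\bigl((0,\infty),\frac{dt}{t^{1-2\sigma_0}}\bigr)$ that vanish almost everywhere on $(1,\infty)$. \textbf{Theorem.} Every function $f_{A,r}$,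 with $A$ an $m$-admissible sequence, belongs to $L^2_*$. Let $K_r$ be the closed linear span in $L^2_*$ of all these functions and, for $\lambda\in\Pi_{\sigma_0}$, let $d_r(\lambda)$ be the distance in $L^2_*$ from $t^{\bar\lambda-2\sigma_0}\chi_{(0,1)}(t)$ to $K_r$. Then, for every $\lambda\in\Pi_{\sigma_0}$, the function $L$ has no zero in $r-\sigma_0+D_r(\lambda)$, where $$D_r(\lambda)=\left\{\mu\in\mathbb C:\ \mu\ne2\sigma_0-\bar\lambda,\ \left|\frac{\mu-\lambda}{\mu+\bar\lambda-2\sigma_0}\right|<\sqrt{1-2(\operatorname{Re}\lambda-\sigma_0)\,d_r(\lambda)^2}\right\}.$$ (If $m\ge1$ and the pole $s=1$ lies in $r-\sigma_0+D_r(\lambda)$, it does not count as a zero.) -/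

import Mathlib

open MeasureTheory Set Filter Topology Asymptotics ComplexConjugate

noncomputable section

namespace DirichletZeroFree

/-- The open half-plane of complex numbers with real part greater than `σ`. -/
def halfPlane (σ : ℝ) : Set ℂ := {z | σ < z.re}

/-- `F` has finite order in the half-plane `Re s > σ`: it is bounded by `exp (|s| ^ A)` for some `A`
at all points of the half-plane of large modulus. -/
def HasFiniteOrderOn (F : ℂ → ℂ) (σ : ℝ) : Prop :=
  ∃ A R : ℝ, ∀ s ∈ halfPlane σ, R ≤ ‖s‖ → ‖F s‖ ≤ Real.exp (‖s‖ ^ A)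

/-- The standing assumptions on the Dirichlet series `∑ a n / n ^ s` (`n ≥ 1`; the value `a 0` plays
no role) and on its continuation `L` to the half-plane `Re s > σ₀`, where `σ₀ < 1`. The only possible
pole of `L` is `1`. It has order exactly `m`; the case `m = 0` means that `L` is analytic at `1`. -/
structure IsContinuedDirichletSeries (a : ℕ → ℂ) (L : ℂ → ℂ) (σ₀ : ℝ) (m : ℕ) : Prop where
  coeff_growth : ∀ ε : ℝ, 0 < ε → a =O[atTop] fun n : ℕ => (n : ℝ) ^ ε
  lt_one : σ₀ < 1
  eq_series : ∀ s : ℂ, 1 < s.re → L s = LSeries a s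
  analytic_off_one : AnalyticOnNhd ℂ L (halfPlane σ₀ \ {1})
  meromorphic_at_one : MeromorphicAt L 1
  analytic_at_one : m = 0 → AnalyticAt ℂ L 1
  pole_order : m ≠ 0 → meromorphicOrderAt L 1 = ((-(m : ℤ) : ℤ) : WithTop ℤ)
  finite_order : HasFiniteOrderOn (fun s => (s - 1) ^ m * L s) σ₀

/-- The standing assumptions on the auxiliary function `φ : [0, ∞) → ℂ` (the values of `φ` at negative
arguments play no role). -/
structure IsAuxiliary (φ : ℝ → ℂ) (σ₀ : ℝ) : Prop where
  measurable : AEStronglyMeasurable φ (volume.restrict (Ici 0))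
  support : ∀ x : ℝ, 1 < x → φ x = 0
  locally_bounded : ∀ x ∈ Ioo (0 : ℝ) 1, ∃ C : ℝ, ∀ᶠ y in 𝓝 x, ‖φ y‖ ≤ C
  growth_zero : φ =O[𝓝[>] 0] fun x : ℝ => x ^ (-σ₀)
  growth_one : ∃ σ₁ : ℝ, σ₁ < 1 / 2 ∧ φ =O[𝓝[<] 1] fun x : ℝ => (1 - x) ^ (-σ₁)

/-- The residue of `F` at an isolated singularity `z₀`, as the (eventually constant) value of the
normalized integrals of `F` over small circles around `z₀`. -/
def residue (F : ℂ → ℂ) (z₀ : ℂ) : ℂ :=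
  limUnder (𝓝[>] (0 : ℝ)) fun ε : ℝ => (2 * Real.pi * Complex.I)⁻¹ * ∮ z in C(z₀, ε), F z

/-- `ψ(u) = Res(L(s) φ̂(s) u ^ s, s = 1) - ∑_{1 ≤ n < u} a n φ(n / u)`, where `φ̂` is the (unnormalized)
Mellin transform. -/
def psi (a : ℕ → ℂ) (L : ℂ → ℂ) (φ : ℝ → ℂ) (u : ℝ) : ℂ :=
  residue (fun s => L s * mellin φ s * (u : ℂ) ^ s) 1
    - ∑ n ∈ Finset.Ico 1 ⌈u⌉₊, a n * φ ((n : ℝ) / u)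

/-- The measure `du / u ^ (1 + 2 r)` on `(1, ∞)`. -/
def tailMeasure (r : ℝ) : Measure ℝ :=
  (volume.restrict (Ioi 1)).withDensity fun u => ENNReal.ofReal (u ^ (-(1 + 2 * r)))

/-- The measure `dt / t ^ (1 - 2 σ₀)` on `(0, ∞)`. -/
def mellinMeasure (σ₀ : ℝ) : Measure ℝ :=
  (volume.restrict (Ioi 0)).withDensity fun t => ENNReal.ofReal (t ^ (-(1 - 2 * σ₀)))

/-- An `m`-admissible sequence `(α, c)`. -/
structure AdmissibleSequence (m : ℕ) where
  /-- the length of the sequence -/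
  len : ℕ
  one_le_len : 1 ≤ len
  /-- the points in `(0, 1]` -/
  α : Fin len → ℝ
  α_mem : ∀ j, α j ∈ Ioc (0 : ℝ) 1
  /-- the coefficients -/
  c : Fin len → ℂ
  sum_eq_zero : ∀ k : ℕ, k < m → ∑ j, c j * (α j : ℂ) * ((Real.log (α j) : ℝ) : ℂ) ^ k = 0

/-- `f_{A,r}(t) = t ^ (r - σ₀) ∑ⱼ cⱼ ψ(αⱼ / t)`. -/
def fA (a : ℕ → ℂ) (L : ℂ → ℂ) (φ : ℝ → ℂ) (σ₀ r : ℝ) {m : ℕ} (A : AdmissibleSequence m)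
    (t : ℝ) : ℂ :=
  ((t ^ (r - σ₀) : ℝ) : ℂ) * ∑ j, A.c j * psi a L φ (A.α j / t)

/-- The function `f` belongs to `L²_*((0,1), dt / t ^ (1 - 2 σ₀))`, the space of those functions in
`L²((0,∞), dt / t ^ (1 - 2 σ₀))` that vanish almost everywhere on `(1, ∞)`. -/
def MemLstar (f : ℝ → ℂ) (σ₀ : ℝ) : Prop :=
  MemLp f 2 (mellinMeasure σ₀) ∧ ∀ᵐ t : ℝ, 1 < t → f t = 0

/-- `L²_*((0,1), dt / t ^ (1 - 2 σ₀))` as a subspace of `L²((0,∞), dt / t ^ (1 - 2 σ₀))`. -/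
def Lstar (σ₀ : ℝ) : Submodule ℂ (Lp ℂ 2 (mellinMeasure σ₀)) where
  carrier := {g | ∀ᵐ t ∂(mellinMeasure σ₀), 1 < t → g t = 0}
  zero_mem' := by
    filter_upwards [Lp.coeFn_zero ℂ 2 (mellinMeasure σ₀)] with t ht _
    simpa using ht
  add_mem' := by
    intro f g hf hg
    filter_upwards [hf, hg, Lp.coeFn_add f g] with t h1 h2 h3 ht
    rw [h3, Pi.add_apply, h1 ht, h2 ht, add_zero]
  smul_mem' := by
    intro c f hf
    filter_upwards [hf, Lp.coeFn_smul c f] with t h1 h3 ht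
    rw [h3, Pi.smul_apply, h1 ht, smul_zero]

/-- `K_r`: the closed span in `L²_*((0,1), dt / t ^ (1 - 2 σ₀))` of the functions `f_{A,r}`, where `A`
runs over the `m`-admissible sequences. -/
def K (a : ℕ → ℂ) (L : ℂ → ℂ) (φ : ℝ → ℂ) (σ₀ r : ℝ) (m : ℕ) : Submodule ℂ (Lstar σ₀) :=
  (Submodule.span ℂ {g : Lstar σ₀ | ∃ A : AdmissibleSequence m,
    (g : Lp ℂ 2 (mellinMeasure σ₀)) =ᵐ[mellinMeasure σ₀] fA a L φ σ₀ r A}).topologicalClosure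

/-- The function `t ^ (conj lam - 2 σ₀) χ_{(0,1)}(t)`. -/
def target (σ₀ : ℝ) (lam : ℂ) : ℝ → ℂ :=
  (Ioo (0 : ℝ) 1).indicator fun t => (t : ℂ) ^ (conj lam - 2 * (σ₀ : ℂ))

theorem memLp_target {σ₀ : ℝ} {lam : ℂ} (h : lam ∈ halfPlane σ₀) :
    MemLp (target σ₀ lam) 2 (mellinMeasure σ₀) := by
  have hlam : σ₀ < lam.re := h
  have hm : AEStronglyMeasurable (target σ₀ lam) (mellinMeasure σ₀) := by
    refine Measurable.aestronglyMeasurable ?_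
    refine Measurable.indicator ?_ measurableSet_Ioo
    exact Complex.measurable_ofReal.pow_const _
  rw [memLp_two_iff_integrable_sq_norm hm]
  unfold mellinMeasure
  rw [integrable_withDensity_iff (by fun_prop) (by simp)]
  have h1 : IntegrableOn (fun t : ℝ => t ^ (2 * (lam.re - σ₀) - 1)) (Ioo 0 1) := by
    rw [intervalIntegral.integrableOn_Ioo_rpow_iff one_pos]
    linarith
  have h2 := (h1.integrable_indicator measurableSet_Ioo).integrableOn (s := Ioi (0 : ℝ))
  refine IntegrableOn.congr_fun h2 ?_ measurableSet_Ioi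
  intro t ht
  have ht0 : 0 < t := ht
  by_cases hmem : t ∈ Ioo (0 : ℝ) 1
  · simp only [target, indicator_of_mem hmem]
    rw [Complex.norm_cpow_eq_rpow_re_of_pos ht0,
      ENNReal.toReal_ofReal (Real.rpow_nonneg ht0.le _), ← Real.rpow_natCast,
      ← Real.rpow_mul ht0.le, ← Real.rpow_add ht0]
    congr 1
    simp
    ring
  · simp [target, indicator_of_notMem hmem]

theorem toLp_target_mem {σ₀ : ℝ} {lam : ℂ} (h : lam ∈ halfPlane σ₀) :
    (memLp_target h).toLp (target σ₀ lam) ∈ Lstar σ₀ := by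
  change ∀ᵐ t ∂(mellinMeasure σ₀), 1 < t → (memLp_target h).toLp (target σ₀ lam) t = 0
  filter_upwards [(memLp_target h).coeFn_toLp] with t ht h1
  rw [ht, target, indicator_of_notMem]
  exact fun hh => (lt_asymm h1 hh.2).elim

/-- `d_r(lam)`: the distance in `L²_*((0,1), dt / t ^ (1 - 2 σ₀))` from
`t ^ (conj lam - 2 σ₀) χ_{(0,1)}(t)` to `K_r`. -/
def d (a : ℕ → ℂ) (L : ℂ → ℂ) (φ : ℝ → ℂ) (σ₀ r : ℝ) (m : ℕ) {lam : ℂ}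
    (h : lam ∈ halfPlane σ₀) : ℝ :=
  Metric.infDist (⟨(memLp_target h).toLp (target σ₀ lam), toLp_target_mem h⟩ : Lstar σ₀)
    (K a L φ σ₀ r m : Set (Lstar σ₀))

/-- The disc `D_r(lam)`. The point where the denominator vanishes (the quotient is infinite there) is
excluded explicitly because division by zero is zero here. -/
def D (a : ℕ → ℂ) (L : ℂ → ℂ) (φ : ℝ → ℂ) (σ₀ r : ℝ) (m : ℕ) {lam : ℂ}
    (h : lam ∈ halfPlane σ₀) : Set ℂ :=
  {μ | μ + conj lam - 2 * (σ₀ : ℂ) ≠ 0 ∧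
    ‖(μ - lam) / (μ + conj lam - 2 * (σ₀ : ℂ))‖
      < Real.sqrt (1 - 2 * (lam.re - σ₀) * d a L φ σ₀ r m h ^ 2)}

end DirichletZeroFree

end

/-! For Re μ > σ₀ put k_μ(t) = t^(conj μ - 2σ₀) χ_(0,1)(t). Pairing with k_μ in L²_* is the Mellin
transform at μ, so the k_μ are reproducing kernels, with ⟨k_μ, k_λ⟩ = 1/(μ + conj λ - 2σ₀).

Admissibility says that P(s) = ∑ c_j α_j^s vanishes to order at least m at 1. This zero cancels the
pole of L, so the residues in ∑ c_j ψ(α_j/t) add up to zero (`sum_residue_eq_zero`). What remains is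
-∑ a_n g(nt), with g a combination of dilates of φ, and its Mellin transform is -L(s) P(s) φ̂(s) for
Re s > 1. The same cancellation makes f_A vanish for t > 1, so that f_A lies in L²_*. Its Mellin
transform is then holomorphic on Re μ > σ₀, and the identity theorem carries the formula to Re s > r
(`mellin_sum_psi`).

If L(r - σ₀ + μ) = 0, then k_μ is orthogonal to every f_A, hence to K_r, and Cauchy–Schwarz gives
d_r(λ) ≥ |⟨k_μ, k_λ⟩| / ‖k_μ‖ (`le_d_sq`). By the identity `norm_sq_sub_norm_sq` this bound says
exactly that μ lies outside D_r(λ). -/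

namespace DirichletZeroFree

/-! ### Mellin transforms of functions supported on [0, 1] -/

/-- The Mellin transform of a function supported on `[0, 1]` converges to the right of any real
point of convergence. -/
theorem mellinConvergent_of_support {f : ℝ → ℂ} {σ : ℝ} (hf : MellinConvergent f σ)
    (h0 : ∀ᵐ t : ℝ, 1 < t → f t = 0) {s : ℂ} (hs : σ ≤ s.re) : MellinConvergent f s := by
  have hmeas : AEStronglyMeasurable (fun t : ℝ => (t : ℂ) ^ (s - 1) • f t)
      (volume.restrict (Ioi 0)) := by
    have h1 : AEStronglyMeasurable (fun t : ℝ => (t : ℂ) ^ (s - σ)) (volume.restrict (Ioi 0)) :=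
      (Complex.measurable_ofReal.pow_const _).aestronglyMeasurable
    refine (h1.smul hf.aestronglyMeasurable).congr ?_
    filter_upwards [ae_restrict_mem measurableSet_Ioi] with t ht
    have ht0 : (t : ℂ) ≠ 0 := Complex.ofReal_ne_zero.2 (ne_of_gt ht)
    simp only [Pi.smul_apply', smul_eq_mul]
    rw [← mul_assoc, ← Complex.cpow_add _ _ ht0]
    congr 2
    ring
  refine Integrable.mono hf hmeas ?_
  filter_upwards [ae_restrict_mem measurableSet_Ioi, ae_restrict_of_ae h0] with t ht h
  have ht : 0 < t := ht
  by_cases h1 : 1 < t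
  · simp [h h1]
  · rw [norm_smul, norm_smul, Complex.norm_cpow_eq_rpow_re_of_pos ht,
      Complex.norm_cpow_eq_rpow_re_of_pos ht]
    gcongr ?_ * _
    exact Real.rpow_le_rpow_of_exponent_ge ht (not_lt.1 h1) (by simpa using hs)

/-- The Mellin transform of a function supported on `[0, 1]` is holomorphic to the right of any real
point of convergence. -/
theorem differentiableAt_mellin_of_support {f : ℝ → ℂ} {σ : ℝ} (hf : MellinConvergent f σ)
    (h0 : ∀ᵐ t : ℝ, 1 < t → f t = 0) {s : ℂ} (hs : σ < s.re) :
    DifferentiableAt ℂ (mellin f) s := by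
  set δ : ℝ := (s.re - σ) / 2 with hδ
  have hδ0 : 0 < δ := by rw [hδ]; linarith
  have hball : ∀ z ∈ Metric.ball s δ, σ + δ ≤ z.re := by
    intro z hz
    have h1 := (Complex.abs_re_le_norm (z - s)).trans_lt (mem_ball_iff_norm.1 hz)
    have h2 := (abs_lt.1 h1).1
    rw [Complex.sub_re] at h2
    have h3 : s.re = σ + 2 * δ := by rw [hδ]; ring
    linarith
  have hconv : ∀ z ∈ Metric.ball s δ, MellinConvergent f z := fun z hz =>
    mellinConvergent_of_support hf h0 (by linarith [hball z hz])
  have hmem := Metric.ball_mem_nhds s hδ0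
  have key := hasDerivAt_integral_of_dominated_loc_of_deriv_le (μ := volume.restrict (Ioi (0 : ℝ)))
    (F := fun (z : ℂ) (t : ℝ) => (t : ℂ) ^ (z - 1) • f t)
    (F' := fun (z : ℂ) (t : ℝ) => (Complex.log t * (t : ℂ) ^ (z - 1)) • f t)
    -- The ball keeps Re z ≥ σ + δ, and the spare factor t^δ absorbs the logarithm: |log t| t^δ <
    -- 1/δ on (0, 1].
    (bound := fun t : ℝ => δ⁻¹ * ‖(t : ℂ) ^ ((σ : ℂ) - 1) • f t‖)
    hmem (by
      filter_upwards [hmem] with z hz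
      exact (hconv z hz).aestronglyMeasurable) (hconv s (Metric.mem_ball_self hδ0)) (by
      have h1 : AEStronglyMeasurable (fun t : ℝ => Complex.log t) (volume.restrict (Ioi (0 : ℝ))) :=
        (Complex.measurable_log.comp Complex.measurable_ofReal).aestronglyMeasurable
      refine (h1.smul (hconv s (Metric.mem_ball_self hδ0)).aestronglyMeasurable).congr ?_
      filter_upwards with t
      simp [mul_assoc]) ?_ (hf.norm.const_mul _) ?_
  · exact key.2.differentiableAt
  · filter_upwards [ae_restrict_mem measurableSet_Ioi, ae_restrict_of_ae h0] with t ht h z hz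
    have ht : 0 < t := ht
    by_cases h1 : 1 < t
    · simp [h h1]
    have h1 := not_lt.1 h1
    rw [norm_smul, norm_smul, norm_mul, Complex.norm_cpow_eq_rpow_re_of_pos ht,
      Complex.norm_cpow_eq_rpow_re_of_pos ht, ← mul_assoc, ← Complex.ofReal_log ht.le,
      Complex.norm_real]
    gcongr ?_ * _
    have h2 := Real.abs_log_mul_self_rpow_lt t δ ht h1 hδ0
    rw [abs_mul, abs_of_nonneg (Real.rpow_nonneg ht.le _), one_div] at h2
    have h3 : t ^ (z - 1).re ≤ t ^ δ * t ^ ((σ : ℂ) - 1).re := by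
      rw [← Real.rpow_add ht]
      refine Real.rpow_le_rpow_of_exponent_ge ht h1 ?_
      have := hball z hz
      simp
      linarith
    calc ‖Real.log t‖ * t ^ (z - 1).re
        ≤ ‖Real.log t‖ * (t ^ δ * t ^ ((σ : ℂ) - 1).re) := by gcongr
      _ = (|Real.log t| * t ^ δ) * t ^ ((σ : ℂ) - 1).re := by rw [Real.norm_eq_abs]; ring
      _ ≤ _ := by gcongr
  · filter_upwards [ae_restrict_mem measurableSet_Ioi] with t ht z _
    have ht0 : (t : ℂ) ≠ 0 := Complex.ofReal_ne_zero.2 (ne_of_gt ht)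
    have h1 : HasDerivAt (fun z : ℂ => (t : ℂ) ^ (z - 1)) (Complex.log t * (t : ℂ) ^ (z - 1)) z := by
      have := ((hasDerivAt_id z).sub_const 1).const_cpow (c := (t : ℂ)) (Or.inl ht0)
      simpa [mul_comm] using this
    exact h1.smul_const (f t)

/-- The Mellin transform of `t ↦ ∑ aₙ f(n t)` is the product of the Dirichlet series of `a` and the
Mellin transform of `f`. -/
theorem mellin_tsum_comp_mul {f : ℝ → ℂ} {a : ℕ → ℂ} {s : ℂ} (hf : MellinConvergent f s)
    (hf0 : f 0 = 0) (ha : LSeriesSummable a s) :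
    mellin (fun t => ∑' n : ℕ, a n * f (n * t)) s = LSeries a s * mellin f s := by
  have hconv : ∀ n : ℕ, MellinConvergent (fun t => a n * f (n * t)) s := by
    intro n
    rcases Nat.eq_zero_or_pos n with rfl | hn
    -- The term n = 0 is the constant a 0 * f 0, so f 0 = 0 is what removes it; `LSeries.term` is
    -- zero there as well.
    · simp only [Nat.cast_zero, zero_mul, hf0, mul_zero]
      simp [MellinConvergent]
    · have h1 := (MellinConvergent.comp_mul_left (f := f) (s := s)
        (a := (n : ℝ)) (by positivity)).2 hf
      simpa only [smul_eq_mul] using h1.const_smul (a n)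
  have hval : ∀ n : ℕ, mellin (fun t => a n * f (n * t)) s = LSeries.term a s n * mellin f s := by
    intro n
    rcases Nat.eq_zero_or_pos n with rfl | hn
    · simp [hf0, mellin]
    · have h1 := mellin_const_smul (fun t => f (n * t)) s (a n)
      simp only [smul_eq_mul] at h1
      rw [h1, mellin_comp_mul_left _ _ (by positivity : (0 : ℝ) < n), LSeries.term_of_ne_zero hn.ne',
        smul_eq_mul, Complex.cpow_neg]
      push_cast
      ring
  -- Scaling makes the L¹ norms a multiple of |a n| n^(-Re s), so absolute convergence of the
  -- Dirichlet series justifies exchanging sum and integral.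
  have hnorm : ∀ n : ℕ, ∫ t in Ioi (0 : ℝ), ‖(t : ℂ) ^ (s - 1) • (a n * f (n * t))‖
      = ‖LSeries.term a s n‖ * ∫ t in Ioi (0 : ℝ), ‖(t : ℂ) ^ (s - 1) • f t‖ := by
    intro n
    rcases Nat.eq_zero_or_pos n with rfl | hn
    · simp [hf0]
    have hn' : (0 : ℝ) < n := by positivity
    have h1 := integral_comp_mul_left_Ioi (fun t : ℝ => ‖(t : ℂ) ^ (s - 1) • f t‖) 0 hn'
    rw [mul_zero, smul_eq_mul] at h1
    rw [LSeries.term_of_ne_zero hn.ne', norm_div,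
      Complex.norm_natCast_cpow_of_pos hn, ← mul_inv_cancel_left₀ hn'.ne'
        (∫ t in Ioi (0 : ℝ), ‖(t : ℂ) ^ (s - 1) • f t‖), ← h1, ← integral_const_mul,
        ← integral_const_mul]
    refine setIntegral_congr_fun measurableSet_Ioi fun t ht => ?_
    have ht : 0 < t := ht
    simp only [norm_smul, norm_mul]
    rw [Complex.norm_cpow_eq_rpow_re_of_pos ht, Complex.norm_cpow_eq_rpow_re_of_pos (by positivity),
      Real.mul_rpow hn'.le ht.le, Complex.sub_re, Complex.one_re, Real.rpow_sub_one hn'.ne']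
    field_simp
  have hsum := hasSum_integral_of_summable_integral_norm (μ := volume.restrict (Ioi (0 : ℝ)))
    (F := fun (n : ℕ) (t : ℝ) => (t : ℂ) ^ (s - 1) • (a n * f (n * t))) hconv (by
      simp_rw [hnorm]
      exact ha.norm.mul_right _)
  have h2 : HasSum (fun n => LSeries.term a s n * mellin f s) (LSeries a s * mellin f s) :=
    ha.hasSum.mul_right _
  have h3 : (fun n : ℕ => ∫ t in Ioi (0 : ℝ), (t : ℂ) ^ (s - 1) • (a n * f (n * t)))
      = fun n => LSeries.term a s n * mellin f s := funext hval
  rw [h3] at hsum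
  rw [← hsum.unique h2, mellin]
  refine setIntegral_congr_fun measurableSet_Ioi fun t _ => ?_
  simp [tsum_mul_left]

/-! ### The Mellin transform of φ -/

theorem IsAuxiliary.locallyIntegrableOn {φ : ℝ → ℂ} {σ₀ : ℝ} (hφ : IsAuxiliary φ σ₀) :
    LocallyIntegrableOn φ (Ioi 0) := by
  intro x hx
  have hx : 0 < x := hx
  have hm : AEStronglyMeasurable φ (volume.restrict (Ioi 0)) :=
    hφ.measurable.mono_measure (Measure.restrict_mono Ioi_subset_Ici_self le_rfl)
  have hsm : StronglyMeasurableAtFilter φ (𝓝 x) := ⟨Ioi 0, Ioi_mem_nhds hx, hm⟩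
  refine IntegrableAtFilter.filter_mono nhdsWithin_le_nhds ?_
  rcases lt_trichotomy x 1 with h | rfl | h
  · obtain ⟨C, hC⟩ := hφ.locally_bounded x ⟨hx, h⟩
    exact (Measure.finiteAt_nhds volume x).integrableAtFilter hsm ⟨C, hC⟩
  · obtain ⟨σ₁, hσ₁, hO⟩ := hφ.growth_one
    -- At 1 the left side uses the growth bound (integrable since σ₁ < 1), the right side the
    -- support, and the point itself is null.
    rw [← nhdsNE_sup_pure, ← nhdsLT_sup_nhdsGT, sup_assoc, IntegrableAtFilter.sup_iff,
      IntegrableAtFilter.sup_iff]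
    refine ⟨hO.integrableAtFilter (hsm.filter_mono nhdsWithin_le_nhds) ?_, ?_, ?_⟩
    · refine ⟨Ioo 0 1, Ioo_mem_nhdsLT one_pos, ?_⟩
      have h1 : IntervalIntegrable (fun x : ℝ => x ^ (-σ₁)) volume 0 1 :=
        intervalIntegral.intervalIntegrable_rpow' (by linarith)
      have h2 := h1.comp_sub_left 1
      simp only [sub_zero, sub_self] at h2
      exact ((intervalIntegrable_iff_integrableOn_Ioo_of_le zero_le_one).1 h2.symm)
    · refine ⟨Ioi 1, self_mem_nhdsWithin, ?_⟩
      exact integrableOn_zero.congr_fun (fun t ht => (hφ.support t ht).symm) measurableSet_Ioi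
    · exact ⟨{1}, mem_pure.2 rfl, by simp⟩
  · refine ⟨Ioi 1, Ioi_mem_nhds h, ?_⟩
    exact integrableOn_zero.congr_fun (fun t ht => (hφ.support t ht).symm) measurableSet_Ioi

theorem IsAuxiliary.isBigO_atTop {φ : ℝ → ℂ} {σ₀ : ℝ} (hφ : IsAuxiliary φ σ₀) (b : ℝ) :
    φ =O[atTop] fun t : ℝ => t ^ (-b) := by
  have h : φ =ᶠ[atTop] fun _ => 0 := by
    filter_upwards [eventually_gt_atTop 1] with t ht using hφ.support t ht
  exact h.trans_isBigO (isBigO_zero _ _)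

theorem IsAuxiliary.mellinConvergent {φ : ℝ → ℂ} {σ₀ : ℝ} (hφ : IsAuxiliary φ σ₀) {s : ℂ}
    (hs : σ₀ < s.re) : MellinConvergent φ s :=
  mellinConvergent_of_isBigO_rpow hφ.locallyIntegrableOn (hφ.isBigO_atTop (s.re + 1))
    (by linarith) hφ.growth_zero hs

theorem IsAuxiliary.differentiableAt_mellin {φ : ℝ → ℂ} {σ₀ : ℝ} (hφ : IsAuxiliary φ σ₀) {s : ℂ}
    (hs : σ₀ < s.re) : DifferentiableAt ℂ (mellin φ) s :=
  mellin_differentiableAt_of_isBigO_rpow hφ.locallyIntegrableOn (hφ.isBigO_atTop (s.re + 1))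
    (by linarith) hφ.growth_zero hs

theorem isOpen_halfPlane (σ : ℝ) : IsOpen (halfPlane σ) :=
  isOpen_lt continuous_const Complex.continuous_re

theorem IsAuxiliary.analyticOnNhd_mellin {φ : ℝ → ℂ} {σ₀ : ℝ} (hφ : IsAuxiliary φ σ₀) :
    AnalyticOnNhd ℂ (mellin φ) (halfPlane σ₀) :=
  DifferentiableOn.analyticOnNhd
    (fun _ hs => (hφ.differentiableAt_mellin hs).differentiableWithinAt) (isOpen_halfPlane σ₀)

/-! ### Residues -/

/-- The residue is the normalized integral over every small circle. -/
theorem residue_eq_circleIntegral {F : ℂ → ℂ} {z₀ : ℂ} {δ ρ : ℝ}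
    (hF : DifferentiableOn ℂ F (Metric.ball z₀ δ \ {z₀})) (hρ : 0 < ρ) (hρδ : ρ < δ) :
    residue F z₀ = (2 * Real.pi * Complex.I)⁻¹ * ∮ z in C(z₀, ρ), F z := by
  have hopen : IsOpen (Metric.ball z₀ δ \ {z₀}) := Metric.isOpen_ball.sdiff isClosed_singleton
  refine Tendsto.limUnder_eq (tendsto_const_nhds.congr' ?_)
  filter_upwards [Ioo_mem_nhdsGT hρ] with ε hε
  congr 1
  have hsub : Metric.closedBall z₀ ρ \ Metric.ball z₀ ε ⊆ Metric.ball z₀ δ \ {z₀} := by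
    rintro z ⟨h1, h2⟩
    refine ⟨Metric.closedBall_subset_ball hρδ h1, ?_⟩
    rintro rfl
    exact h2 (Metric.mem_ball_self hε.1)
  refine Complex.circleIntegral_eq_of_differentiable_on_annulus_off_countable hε.1 hε.2.le
    countable_empty (hF.continuousOn.mono hsub) fun z hz => ?_
  refine (hF z ?_).differentiableAt (hopen.mem_nhds ?_) <;>
  exact hsub ⟨Metric.ball_subset_closedBall hz.1.1,
    fun h => hz.1.2 (Metric.ball_subset_closedBall h)⟩

/-- Small circles avoid the centre, so F may be replaced by an analytic function that agrees with it
off z₀, and Cauchy's theorem applies. The value F z₀ is irrelevant. -/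
theorem residue_eq_zero {F : ℂ → ℂ} {z₀ : ℂ} (hF : MeromorphicAt F z₀)
    (h : 0 ≤ meromorphicOrderAt F z₀) : residue F z₀ = 0 := by
  obtain ⟨g, hg, hFg⟩ := hF.meromorphicOrderAt_nonneg_iff.1 h
  obtain ⟨δ, hδ, hball⟩ := Metric.eventually_nhds_iff_ball.1
    ((eventually_nhdsWithin_iff.1 hFg).and hg.eventually_analyticAt)
  refine Tendsto.limUnder_eq (tendsto_const_nhds.congr' ?_)
  filter_upwards [Ioo_mem_nhdsGT hδ] with ε hε
  have h1 : (∮ z in C(z₀, ε), F z) = ∮ z in C(z₀, ε), g z := by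
    refine circleIntegral.integral_congr hε.1.le fun z hz => ?_
    refine (hball z (Metric.closedBall_subset_ball hε.2 (Metric.sphere_subset_closedBall hz))).1 ?_
    exact Metric.ne_of_mem_sphere hz hε.1.ne'
  have h2 : (∮ z in C(z₀, ε), g z) = 0 := by
    refine Complex.circleIntegral_eq_zero_of_differentiable_on_off_countable hε.1.le
      countable_empty (fun z hz => ?_) fun z hz => ?_
    · exact (hball z (Metric.closedBall_subset_ball hε.2 hz)).2.continuousAt.continuousWithinAt
    · exact (hball z (Metric.ball_subset_ball hε.2.le hz.1)).2.differentiableAt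
  rw [h1, h2, mul_zero]

/-! ### The zero of the Dirichlet polynomial at 1 -/

theorem analyticAt_ofReal_cpow {u : ℝ} (hu : 0 < u) (s : ℂ) :
    AnalyticAt ℂ (fun s : ℂ => (u : ℂ) ^ s) s :=
  analyticAt_const.cpow analyticAt_id (Or.inl hu)

/-- The Dirichlet polynomial `∑ cⱼ αⱼ ^ s`. -/
noncomputable def AdmissibleSequence.dirichletPoly {m : ℕ} (A : AdmissibleSequence m) (s : ℂ) : ℂ :=
  ∑ j, A.c j * (A.α j : ℂ) ^ s

theorem AdmissibleSequence.analyticAt_dirichletPoly {m : ℕ} (A : AdmissibleSequence m) (s : ℂ) :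
    AnalyticAt ℂ A.dirichletPoly s :=
  Finset.analyticAt_fun_sum _ fun j _ =>
    analyticAt_const.mul (analyticAt_ofReal_cpow (A.α_mem j).1 s)

/-- Writing α_j^s = exp(s log α_j), the k-th derivative at 1 is ∑ c_j α_j (log α_j)^k, which
admissibility kills for k < m. -/
theorem AdmissibleSequence.le_analyticOrderAt {m : ℕ} (A : AdmissibleSequence m) :
    m ≤ analyticOrderAt A.dirichletPoly 1 := by
  rw [natCast_le_analyticOrderAt_iff_iteratedDeriv_eq_zero (A.analyticAt_dirichletPoly 1)]
  intro k hk
  have h1 : A.dirichletPoly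
      = fun s => ∑ j, A.c j * Complex.exp (((Real.log (A.α j) : ℝ) : ℂ) * s) := by
    funext s
    refine Finset.sum_congr rfl fun j _ => ?_
    rw [Complex.cpow_def_of_ne_zero (Complex.ofReal_ne_zero.2 (A.α_mem j).1.ne'),
      Complex.ofReal_log (A.α_mem j).1.le]
  rw [h1, iteratedDeriv_fun_sum fun j _ => ContDiff.contDiffAt (by fun_prop),
    ← A.sum_eq_zero k hk]
  refine Finset.sum_congr rfl fun j _ => ?_
  rw [iteratedDeriv_const_mul_field, iteratedDeriv_cexp_const_mul]
  simp only [mul_one]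
  rw [← Complex.ofReal_exp, Real.exp_log (A.α_mem j).1]
  ring

/-! ### Residue terms of ψ and their cancellation -/

variable {a : ℕ → ℂ} {L : ℂ → ℂ} {φ : ℝ → ℂ} {σ₀ : ℝ} {m : ℕ}

theorem ball_one_subset_halfPlane : Metric.ball 1 (1 - σ₀) ⊆ halfPlane σ₀ := by
  intro z hz
  have h1 := (Complex.abs_re_le_norm (z - 1)).trans_lt (mem_ball_iff_norm.1 hz)
  have h2 := (abs_lt.1 h1).1
  simp only [Complex.sub_re, Complex.one_re] at h2
  change σ₀ < z.re
  linarith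

theorem analyticAt_psi_integrand (hL : IsContinuedDirichletSeries a L σ₀ m)
    (hφ : IsAuxiliary φ σ₀) {u : ℝ} (hu : 0 < u) {s : ℂ} (hs : s ∈ halfPlane σ₀ \ {1}) :
    AnalyticAt ℂ (fun s => L s * mellin φ s * (u : ℂ) ^ s) s :=
  ((hL.analytic_off_one s hs).mul (hφ.analyticOnNhd_mellin s hs.1)).mul
    (analyticAt_ofReal_cpow hu s)

/-- The radius does not depend on u, which allows both continuity in u and linear combinations under
one contour integral. -/
theorem residue_psi_integrand (hL : IsContinuedDirichletSeries a L σ₀ m)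
    (hφ : IsAuxiliary φ σ₀) {u : ℝ} (hu : 0 < u) :
    residue (fun s => L s * mellin φ s * (u : ℂ) ^ s) 1 = (2 * Real.pi * Complex.I)⁻¹ *
      ∮ s in C(1, (1 - σ₀) / 2), L s * mellin φ s * (u : ℂ) ^ s := by
  have h1 := hL.lt_one
  refine residue_eq_circleIntegral (δ := 1 - σ₀) (fun s hs => ?_) (by linarith) (by linarith)
  exact (analyticAt_psi_integrand hL hφ hu
    ⟨ball_one_subset_halfPlane hs.1, hs.2⟩).differentiableAt.differentiableWithinAt

theorem circleMap_mem_halfPlane (h1 : σ₀ < 1) (θ : ℝ) :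
    circleMap 1 ((1 - σ₀) / 2) θ ∈ halfPlane σ₀ \ {1} := by
  have h2 : circleMap 1 ((1 - σ₀) / 2) θ ∈ Metric.sphere (1 : ℂ) ((1 - σ₀) / 2) :=
    circleMap_mem_sphere _ (by linarith) _
  exact ⟨ball_one_subset_halfPlane (Metric.closedBall_subset_ball (by linarith)
    (Metric.sphere_subset_closedBall h2)), Metric.ne_of_mem_sphere h2 (by linarith)⟩

theorem continuousOn_residue (hL : IsContinuedDirichletSeries a L σ₀ m) (hφ : IsAuxiliary φ σ₀) :
    ContinuousOn (fun u : ℝ => residue (fun s => L s * mellin φ s * (u : ℂ) ^ s) 1) (Ioi 0) := by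
  have hg : Continuous fun θ : ℝ => L (circleMap 1 ((1 - σ₀) / 2) θ) *
      mellin φ (circleMap 1 ((1 - σ₀) / 2) θ) := by
    refine continuous_iff_continuousAt.2 fun θ => ?_
    have hθ := circleMap_mem_halfPlane hL.lt_one θ
    have h2 := ((hL.analytic_off_one _ hθ).mul (hφ.analyticOnNhd_mellin _ hθ.1)).continuousAt
    exact ContinuousAt.comp (f := circleMap 1 ((1 - σ₀) / 2)) (g := fun s => L s * mellin φ s) h2
      (continuous_circleMap _ _).continuousAt
  -- With u = e^x the integrand becomes jointly continuous on the whole plane of parameters.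
  have hH : Continuous fun x : ℝ => ∮ s in C(1, (1 - σ₀) / 2),
      L s * mellin φ s * Complex.exp (x * s) := by
    unfold circleIntegral
    refine intervalIntegral.continuous_parametric_intervalIntegral_of_continuous' ?_ _ _
    simp only [deriv_circleMap]
    have h3 := hg.comp (continuous_snd (X := ℝ))
    have h5 : Continuous fun p : ℝ × ℝ => circleMap 0 ((1 - σ₀) / 2) p.2 * Complex.I :=
      ((continuous_circleMap _ _).comp continuous_snd).mul continuous_const
    have h6 : Continuous fun p : ℝ × ℝ =>
        Complex.exp ((p.1 : ℂ) * circleMap 1 ((1 - σ₀) / 2) p.2) :=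
      Complex.continuous_exp.comp ((Complex.continuous_ofReal.comp continuous_fst).mul
        ((continuous_circleMap _ _).comp continuous_snd))
    exact h5.smul (h3.mul h6)
  have h4 : ContinuousOn (fun u : ℝ => (2 * Real.pi * Complex.I)⁻¹ * ∮ s in C(1, (1 - σ₀) / 2),
      L s * mellin φ s * Complex.exp (Real.log u * s)) (Ioi 0) :=
    continuousOn_const.mul (hH.comp_continuousOn
      (Real.continuousOn_log.mono fun u hu => ne_of_gt hu))
  refine h4.congr fun u hu => ?_
  have hu : 0 < u := hu
  simp only
  rw [residue_psi_integrand hL hφ hu]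
  congr 2
  funext s
  rw [Complex.cpow_def_of_ne_zero (Complex.ofReal_ne_zero.2 hu.ne'), Complex.ofReal_log hu.le]

/-- The combination is the residue of L(s) φ̂(s) t^(-s) P(s), and the zero of P at 1 cancels the
pole of L. -/
theorem sum_residue_eq_zero (hL : IsContinuedDirichletSeries a L σ₀ m) (hφ : IsAuxiliary φ σ₀)
    (A : AdmissibleSequence m) {t : ℝ} (ht : 0 < t) :
    ∑ j, A.c j * residue (fun s => L s * mellin φ s * ((A.α j / t : ℝ) : ℂ) ^ s) 1 = 0 := by
  have hα : ∀ j, 0 < A.α j / t := fun j => div_pos (A.α_mem j).1 ht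
  have h1lt := hL.lt_one
  have hmem : (1 : ℂ) ∈ halfPlane σ₀ := by
    change σ₀ < (1 : ℂ).re
    simpa using h1lt
  have hfun : ∀ s : ℂ, ∑ j, A.c j * (L s * mellin φ s * ((A.α j / t : ℝ) : ℂ) ^ s)
      = L s * (mellin φ s * ((t⁻¹ : ℝ) : ℂ) ^ s * A.dirichletPoly s) := by
    intro s
    rw [AdmissibleSequence.dirichletPoly, Finset.mul_sum, Finset.mul_sum]
    refine Finset.sum_congr rfl fun j _ => ?_
    rw [div_eq_mul_inv, Complex.ofReal_mul,
      Complex.mul_cpow_ofReal_nonneg (A.α_mem j).1.le (inv_nonneg.2 ht.le)]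
    ring
  have hci : ∀ j, CircleIntegrable
      (fun s => A.c j * (L s * mellin φ s * ((A.α j / t : ℝ) : ℂ) ^ s)) 1 ((1 - σ₀) / 2) := by
    intro j
    refine ContinuousOn.circleIntegrable (by linarith) fun s hs => ?_
    refine (AnalyticAt.continuousAt (𝕜 := ℂ) ?_).continuousWithinAt
    refine analyticAt_const.mul (analyticAt_psi_integrand hL hφ (hα j) ⟨?_, ?_⟩)
    · exact ball_one_subset_halfPlane (Metric.closedBall_subset_ball (by linarith)
        (Metric.sphere_subset_closedBall hs))
    · exact Metric.ne_of_mem_sphere hs (by linarith)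
  have hres : ∑ j, A.c j * residue (fun s => L s * mellin φ s * ((A.α j / t : ℝ) : ℂ) ^ s) 1
      = residue (fun s => L s * (mellin φ s * ((t⁻¹ : ℝ) : ℂ) ^ s * A.dirichletPoly s)) 1 := by
    rw [residue_eq_circleIntegral (δ := 1 - σ₀) (ρ := (1 - σ₀) / 2) _ (by linarith) (by linarith)]
    · simp_rw [← hfun]
      rw [circleIntegral.integral_fun_sum fun j _ => hci j, Finset.mul_sum]
      refine Finset.sum_congr rfl fun j _ => ?_
      rw [residue_psi_integrand hL hφ (hα j), circleIntegral.integral_const_mul]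
      ring
    · intro s hs
      have hs' := ball_one_subset_halfPlane hs.1
      exact ((hL.analytic_off_one s ⟨hs', hs.2⟩).mul (((hφ.analyticOnNhd_mellin s hs').mul
        (analyticAt_ofReal_cpow (inv_pos.2 ht) s)).mul
          (A.analyticAt_dirichletPoly s))).differentiableAt.differentiableWithinAt
  rw [hres]
  have hB : AnalyticAt ℂ (fun s => mellin φ s * ((t⁻¹ : ℝ) : ℂ) ^ s) 1 :=
    (hφ.analyticOnNhd_mellin 1 hmem).mul (analyticAt_ofReal_cpow (inv_pos.2 ht) 1)
  have hE := A.analyticAt_dirichletPoly 1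
  have hBE : AnalyticAt ℂ (fun s => mellin φ s * ((t⁻¹ : ℝ) : ℂ) ^ s * A.dirichletPoly s) 1 :=
    hB.mul hE
  refine residue_eq_zero (hL.meromorphic_at_one.mul hBE.meromorphicAt) ?_
  have h1 : meromorphicOrderAt
      (fun s => L s * (mellin φ s * ((t⁻¹ : ℝ) : ℂ) ^ s * A.dirichletPoly s)) 1
      = meromorphicOrderAt L 1 + (meromorphicOrderAt (fun s => mellin φ s * ((t⁻¹ : ℝ) : ℂ) ^ s) 1
        + meromorphicOrderAt A.dirichletPoly 1) := by
    rw [← meromorphicOrderAt_mul hB.meromorphicAt hE.meromorphicAt,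
      ← meromorphicOrderAt_mul hL.meromorphic_at_one (hB.meromorphicAt.mul hE.meromorphicAt)]
    rfl
  rw [h1]
  have h2 := hB.meromorphicOrderAt_nonneg
  by_cases hm : m = 0
  · exact add_nonneg (hL.analytic_at_one hm).meromorphicOrderAt_nonneg
      (add_nonneg h2 hE.meromorphicOrderAt_nonneg)
  · have h3 : ((m : ℤ) : WithTop ℤ) ≤ meromorphicOrderAt A.dirichletPoly 1 := by
      rw [hE.meromorphicOrderAt_eq]
      have h4 := A.le_analyticOrderAt
      cases h5 : analyticOrderAt A.dirichletPoly 1 with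
      -- Infinite order occurs when P vanishes identically near 1.
      | top => simp
      | coe n =>
        rw [h5] at h4
        rw [ENat.map_natCast]
        exact_mod_cast h4
    rw [hL.pole_order hm]
    calc (0 : WithTop ℤ) = ((-(m : ℤ) : ℤ) : WithTop ℤ) + (0 + ((m : ℤ) : WithTop ℤ)) := by
          rw [zero_add, ← WithTop.coe_add, neg_add_cancel, WithTop.coe_zero]
      _ ≤ _ := by gcongr

/-! ### Null sets, and the L² pairing as a Mellin transform -/

theorem restrict_absolutelyContinuous_mellinMeasure (σ : ℝ) :
    volume.restrict (Ioi (0 : ℝ)) ≪ mellinMeasure σ := by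
  refine withDensity_absolutelyContinuous' (by fun_prop) ?_
  filter_upwards [ae_restrict_mem measurableSet_Ioi] with t ht
  exact (ENNReal.ofReal_pos.2 (Real.rpow_pos_of_pos ht _)).ne'

theorem restrict_absolutelyContinuous_tailMeasure (r : ℝ) :
    volume.restrict (Ioi (1 : ℝ)) ≪ tailMeasure r := by
  refine withDensity_absolutelyContinuous' (by fun_prop) ?_
  filter_upwards [ae_restrict_mem measurableSet_Ioi] with t ht
  exact (ENNReal.ofReal_pos.2 (Real.rpow_pos_of_pos (one_pos.trans ht) _)).ne'

/-- The involution `t ↦ α / t` of `(0, ∞)` preserves null sets. -/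
theorem quasiMeasurePreserving_div {α : ℝ} (hα : 0 < α) :
    Measure.QuasiMeasurePreserving (fun t : ℝ => α / t) (volume.restrict (Ioi 0))
      (volume.restrict (Ioi 0)) := by
  have hm : Measurable fun t : ℝ => α / t := by fun_prop
  refine ⟨hm, Measure.AbsolutelyContinuous.mk fun s hs h0 => ?_⟩
  rw [Measure.map_apply hm hs, Measure.restrict_apply (hm hs)]
  rw [Measure.restrict_apply hs] at h0
  -- The map is its own inverse on (0, ∞), so preimages of null sets are images of null sets under a
  -- differentiable map.
  refine measure_mono_null (t := (fun t : ℝ => α / t) '' (s ∩ Ioi 0)) ?_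
    (addHaar_image_eq_zero_of_differentiableOn_of_addHaar_eq_zero volume ?_ h0)
  · rintro t ⟨ht, ht0⟩
    have ht0 : 0 < t := ht0
    exact ⟨α / t, ⟨ht, div_pos hα ht0⟩, by field_simp⟩
  · intro t ht
    have ht0 : t ≠ 0 := ne_of_gt ht.2
    exact ((differentiableAt_const α).div differentiableAt_id ht0).differentiableWithinAt

/-- The pairing with `t ^ (conj μ - 2 σ₀) χ_{(0,1)}` in `L²_*` is the Mellin transform at `μ`. -/
theorem hasMellin_inner_target {μ : ℂ} (hμ : μ ∈ halfPlane σ₀)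
    {F : Lp ℂ 2 (mellinMeasure σ₀)} {f : ℝ → ℂ} (hF : F =ᵐ[mellinMeasure σ₀] f)
    (hf : ∀ᵐ t : ℝ, 1 < t → f t = 0) :
    HasMellin f μ (inner ℂ ((memLp_target hμ).toLp (target σ₀ μ)) F) := by
  have hdens : Measurable fun t : ℝ => ENNReal.ofReal (t ^ (-(1 - 2 * σ₀))) := by fun_prop
  have hlt : ∀ᵐ t ∂(volume.restrict (Ioi (0 : ℝ))),
      ENNReal.ofReal (t ^ (-(1 - 2 * σ₀))) < ⊤ := by simp
  -- The weight t^(2σ₀ - 1) times conj(t^(conj μ - 2σ₀)) = t^(μ - 2σ₀) is the Mellin kernel t^(μ -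
  -- 1).
  have hkey : (fun t : ℝ => (ENNReal.ofReal (t ^ (-(1 - 2 * σ₀)))).toReal •
      inner ℂ ((memLp_target hμ).toLp (target σ₀ μ) t) (F t))
      =ᵐ[volume.restrict (Ioi 0)] fun t => (t : ℂ) ^ (μ - 1) • f t := by
    have hac := restrict_absolutelyContinuous_mellinMeasure σ₀
    filter_upwards [ae_restrict_mem measurableSet_Ioi, hac.ae_eq (memLp_target hμ).coeFn_toLp,
      hac.ae_eq hF, ae_restrict_of_ae hf, ae_restrict_of_ae (Measure.ae_ne volume (1 : ℝ))]
      with t ht h1 h2 h3 h4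
    have ht : 0 < t := ht
    have ht0 : (t : ℂ) ≠ 0 := Complex.ofReal_ne_zero.2 ht.ne'
    rw [h1, h2, ENNReal.toReal_ofReal (Real.rpow_nonneg ht.le _)]
    rcases lt_or_gt_of_ne h4 with h | h
    · rw [target, indicator_of_mem (show t ∈ Ioo (0 : ℝ) 1 from ⟨ht, h⟩), RCLike.inner_apply,
        Complex.real_smul, Complex.ofReal_cpow ht.le, smul_eq_mul]
      have harg : (t : ℂ).arg ≠ Real.pi := by
        rw [Complex.arg_ofReal_of_nonneg ht.le]
        exact Real.pi_pos.ne
      have hconj : conj ((t : ℂ) ^ (conj μ - 2 * (σ₀ : ℂ))) = (t : ℂ) ^ (μ - 2 * (σ₀ : ℂ)) := by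
        have he : conj μ - 2 * (σ₀ : ℂ) = conj (μ - 2 * (σ₀ : ℂ)) := by
          rw [map_sub, map_mul, Complex.conj_ofReal, Complex.conj_ofNat]
        rw [he, Complex.cpow_conj _ _ harg, Complex.conj_ofReal, Complex.conj_conj]
      rw [hconj, mul_comm (f t), ← mul_assoc, ← Complex.cpow_add _ _ ht0]
      congr 2
      push_cast
      ring
    · simp [h3 h]
  have hint := L2.integrable_inner (𝕜 := ℂ) ((memLp_target hμ).toLp (target σ₀ μ)) F
  refine ⟨?_, ?_⟩
  · exact ((integrable_withDensity_iff_integrable_smul' hdens hlt).1 hint).congr hkey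
  · exact ((L2.inner_def _ _).trans ((integral_withDensity_eq_integral_toReal_smul hdens hlt _).trans
      (integral_congr_ae hkey))).symm

/-! ### Membership of f_A in L²_* -/

variable {r : ℝ}

theorem psi_eq_residue {u : ℝ} (hu : u ≤ 1) :
    psi a L φ u = residue (fun s => L s * mellin φ s * (u : ℂ) ^ s) 1 := by
  have h : ⌈u⌉₊ ≤ 1 := Nat.ceil_le.2 (by simpa using hu)
  rw [psi, Finset.Ico_eq_empty_of_le h, Finset.sum_empty, sub_zero]

/-- For t > 1 every α_j/t is below 1, so the sums in ψ are empty and only the cancelling residues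
remain. -/
theorem fA_eq_zero (hL : IsContinuedDirichletSeries a L σ₀ m) (hφ : IsAuxiliary φ σ₀)
    (A : AdmissibleSequence m) {t : ℝ} (ht : 1 < t) : fA a L φ σ₀ r A t = 0 := by
  have ht0 : 0 < t := one_pos.trans ht
  have h : ∑ j, A.c j * psi a L φ (A.α j / t) = 0 := by
    rw [← sum_residue_eq_zero hL hφ A ht0]
    refine Finset.sum_congr rfl fun j _ => ?_
    rw [psi_eq_residue]
    exact (div_le_one ht0).2 ((A.α_mem j).2.trans ht.le)
  rw [fA, h, mul_zero]

theorem continuousOn_psi (hL : IsContinuedDirichletSeries a L σ₀ m) (hφ : IsAuxiliary φ σ₀) :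
    ContinuousOn (psi a L φ) (Ioc 0 1) :=
  ((continuousOn_residue hL hφ).mono Ioc_subset_Ioi_self).congr fun _ hu => psi_eq_residue hu.2

theorem aestronglyMeasurable_psi (hL : IsContinuedDirichletSeries a L σ₀ m)
    (hφ : IsAuxiliary φ σ₀) (hψ : MemLp (psi a L φ) 2 (tailMeasure r)) :
    AEStronglyMeasurable (psi a L φ) (volume.restrict (Ioi 0)) := by
  rw [← Ioc_union_Ioi_eq_Ioi (zero_le_one (α := ℝ)), aestronglyMeasurable_union_iff]
  exact ⟨(continuousOn_psi hL hφ).aestronglyMeasurable measurableSet_Ioc,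
    hψ.1.mono_ac (restrict_absolutelyContinuous_tailMeasure r)⟩

/-- Finiteness of ∫_α^∞ |ψ|² u^(-1-2r) du, phrased as Mellin convergence so that the substitution u
= α/t follows from the Mellin scaling rules. On [α, 1] it comes from continuity, beyond 1 from the
hypothesis on ψ. -/
theorem mellinConvergent_norm_sq_psi (hL : IsContinuedDirichletSeries a L σ₀ m)
    (hφ : IsAuxiliary φ σ₀) (hψ : MemLp (psi a L φ) 2 (tailMeasure r)) {α : ℝ} (hα : 0 < α) :
    MellinConvergent ((Ici α).indicator fun u => ((‖psi a L φ u‖ ^ 2 : ℝ) : ℂ))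
      ((-(2 * r) : ℝ) : ℂ) := by
  have h1 : IntegrableOn (fun u : ℝ => (u : ℂ) ^ (((-(2 * r) : ℝ) : ℂ) - 1) •
      ((‖psi a L φ u‖ ^ 2 : ℝ) : ℂ)) (Ioi 1) := by
    have h2 := (memLp_two_iff_integrable_sq_norm hψ.1).1 hψ
    rw [tailMeasure, integrable_withDensity_iff (by fun_prop) (by simp)] at h2
    have h3 : IntegrableOn (fun u : ℝ => ((‖psi a L φ u‖ ^ 2 *
        (ENNReal.ofReal (u ^ (-(1 + 2 * r)))).toReal : ℝ) : ℂ)) (Ioi 1) := h2.ofReal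
    refine IntegrableOn.congr_fun h3 (fun u hu => ?_) measurableSet_Ioi
    have hu : 0 < u := one_pos.trans hu
    simp only [smul_eq_mul]
    rw [ENNReal.toReal_ofReal (Real.rpow_nonneg hu.le _)]
    push_cast
    rw [Complex.ofReal_cpow hu.le, mul_comm]
    congr 2
    push_cast
    ring
  have h3 : IntegrableOn (fun u : ℝ => (u : ℂ) ^ (((-(2 * r) : ℝ) : ℂ) - 1) •
      ((‖psi a L φ u‖ ^ 2 : ℝ) : ℂ)) (Icc α 1) := by
    refine ContinuousOn.integrableOn_Icc ?_
    have h4 : Icc α 1 ⊆ Ioc 0 1 := fun u hu => ⟨hα.trans_le hu.1, hu.2⟩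
    refine ContinuousOn.fun_smul (fun u hu => ?_) ?_
    · exact ((Complex.continuousAt_ofReal_cpow_const _ _
        (Or.inr (hα.trans_le hu.1).ne'))).continuousWithinAt
    · exact Complex.continuous_ofReal.comp_continuousOn
        (((continuousOn_psi hL hφ).mono h4).norm.pow 2)
  have h5 := h3.union h1
  have h6 : (fun u : ℝ => (u : ℂ) ^ (((-(2 * r) : ℝ) : ℂ) - 1) •
      (Ici α).indicator (fun u => ((‖psi a L φ u‖ ^ 2 : ℝ) : ℂ)) u)
      = (Ici α).indicator fun u : ℝ => (u : ℂ) ^ (((-(2 * r) : ℝ) : ℂ) - 1) •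
      ((‖psi a L φ u‖ ^ 2 : ℝ) : ℂ) := by
    funext u
    by_cases hu : u ∈ Ici α
    · simp [indicator_of_mem hu]
    · simp [indicator_of_notMem hu]
  rw [MellinConvergent, h6]
  refine ((integrable_indicator_iff measurableSet_Ici).2 (h5.mono_set fun u hu => ?_)).integrableOn
  exact (le_or_gt u 1).imp (fun h => ⟨hu, h⟩) id

/-- Substituting u = α/t turns the squared norm into α^(2r) ∫_α^∞ |ψ|² u^(-1-2r) du. The cut-off to
(0, 1] is there because a single summand need not vanish for t > 1. -/
theorem memLp_indicator_psi (hL : IsContinuedDirichletSeries a L σ₀ m)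
    (hφ : IsAuxiliary φ σ₀) (hψ : MemLp (psi a L φ) 2 (tailMeasure r)) {α : ℝ} (hα : 0 < α) :
    MemLp ((Ioc 0 1).indicator fun t => ((t ^ (r - σ₀) : ℝ) : ℂ) * psi a L φ (α / t)) 2
      (mellinMeasure σ₀) := by
  have hm : AEStronglyMeasurable ((Ioc (0 : ℝ) 1).indicator fun t =>
      ((t ^ (r - σ₀) : ℝ) : ℂ) * psi a L φ (α / t)) (mellinMeasure σ₀) := by
    have h1 := (aestronglyMeasurable_psi hL hφ hψ).comp_quasiMeasurePreserving
      (quasiMeasurePreserving_div hα)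
    have h2 : Measurable fun t : ℝ => ((t ^ (r - σ₀) : ℝ) : ℂ) := by fun_prop
    exact ((h2.aestronglyMeasurable.mul h1).indicator measurableSet_Ioc).mono_ac
      (withDensity_absolutelyContinuous _ _)
  rw [memLp_two_iff_integrable_sq_norm hm, mellinMeasure,
    integrable_withDensity_iff (by fun_prop) (by simp)]
  have h1 := (MellinConvergent.comp_mul_left hα).2 (mellinConvergent_norm_sq_psi hL hφ hψ hα)
  have h2 : MellinConvergent (fun t : ℝ => (Ici α).indicator
      (fun u => ((‖psi a L φ u‖ ^ 2 : ℝ) : ℂ)) (α * t ^ (-1 : ℝ))) ((2 * r : ℝ) : ℂ) := by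
    refine (MellinConvergent.comp_rpow (f := fun t : ℝ => (Ici α).indicator
      (fun u => ((‖psi a L φ u‖ ^ 2 : ℝ) : ℂ)) (α * t)) (by norm_num : (-1 : ℝ) ≠ 0)).2 ?_
    convert h1 using 1
    push_cast
    ring
  refine IntegrableOn.congr_fun (Integrable.norm h2) (fun t ht => ?_) measurableSet_Ioi
  have ht : 0 < t := ht
  simp only [norm_smul]
  rw [Complex.norm_cpow_eq_rpow_re_of_pos ht, Real.rpow_neg_one, ← div_eq_mul_inv,
    ENNReal.toReal_ofReal (Real.rpow_nonneg ht.le _)]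
  by_cases h : t ≤ 1
  · have h3 : α / t ∈ Ici α := (le_div_iff₀ ht).2 (mul_le_of_le_one_right hα.le h)
    rw [indicator_of_mem h3, indicator_of_mem (show t ∈ Ioc (0 : ℝ) 1 from ⟨ht, h⟩), norm_mul,
      Complex.norm_real, Complex.norm_real, norm_pow, norm_norm, mul_pow,
      Real.norm_of_nonneg (Real.rpow_nonneg ht.le _), ← Real.rpow_mul_natCast ht.le,
      mul_right_comm, ← Real.rpow_add ht]
    congr 2
    simp
    ring
  · have h3 : α / t ∉ Ici α := fun h4 => h (by
      have h5 := (le_div_iff₀ ht).1 h4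
      nlinarith)
    rw [indicator_of_notMem h3, indicator_of_notMem (fun h4 => h h4.2)]
    simp

theorem memLstar_fA (hL : IsContinuedDirichletSeries a L σ₀ m)
    (hφ : IsAuxiliary φ σ₀) (hψ : MemLp (psi a L φ) 2 (tailMeasure r)) (A : AdmissibleSequence m) :
    MemLstar (fA a L φ σ₀ r A) σ₀ := by
  refine ⟨?_, Eventually.of_forall fun t ht => fA_eq_zero hL hφ A ht⟩
  have h1 : MemLp (fun t => ∑ j, A.c j * (Ioc 0 1).indicator (fun t =>
      ((t ^ (r - σ₀) : ℝ) : ℂ) * psi a L φ (A.α j / t)) t) 2 (mellinMeasure σ₀) :=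
    memLp_finsetSum _ fun j _ => (memLp_indicator_psi hL hφ hψ (A.α_mem j).1).const_mul _
  refine h1.ae_eq ((withDensity_absolutelyContinuous _ _).ae_eq ?_)
  filter_upwards [ae_restrict_mem measurableSet_Ioi] with t ht
  by_cases h : t ≤ 1
  · rw [fA, Finset.mul_sum]
    refine Finset.sum_congr rfl fun j _ => ?_
    rw [indicator_of_mem (show t ∈ Ioc (0 : ℝ) 1 from ⟨ht, h⟩)]
    ring
  · rw [fA_eq_zero hL hφ A (not_le.1 h)]
    refine Finset.sum_eq_zero fun j _ => ?_
    rw [indicator_of_notMem (fun h4 => h h4.2), mul_zero]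

/-! ### The Mellin transform of f_A -/

/-- The restriction of `φ` to `(0, 1)`. -/
noncomputable def openPart (φ : ℝ → ℂ) : ℝ → ℂ := (Ioo 0 1).indicator φ

theorem hasMellin_openPart (hφ : IsAuxiliary φ σ₀) {s : ℂ} (hs : σ₀ < s.re) :
    HasMellin (openPart φ) s (mellin φ s) := by
  have h : (fun t : ℝ => (t : ℂ) ^ (s - 1) • φ t) =ᵐ[volume.restrict (Ioi 0)]
      fun t : ℝ => (t : ℂ) ^ (s - 1) • openPart φ t := by
    filter_upwards [ae_restrict_mem measurableSet_Ioi,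
      ae_restrict_of_ae (Measure.ae_ne volume (1 : ℝ))] with t ht h1
    rcases lt_or_gt_of_ne h1 with h | h
    · rw [openPart, indicator_of_mem (show t ∈ Ioo (0 : ℝ) 1 from ⟨ht, h⟩)]
    · rw [openPart, indicator_of_notMem (fun h4 => lt_asymm h h4.2), hφ.support t h]
  exact ⟨(hφ.mellinConvergent hs).congr h, (integral_congr_ae h).symm⟩

/-- The open interval matches the range 1 ≤ n < u: it drops both n = 0 and n = u. -/
theorem hasSum_openPart {u : ℝ} (hu : 0 < u) :
    HasSum (fun n : ℕ => a n * openPart φ (n / u))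
      (∑ n ∈ Finset.Ico 1 ⌈u⌉₊, a n * φ ((n : ℝ) / u)) := by
  have h : ∑ n ∈ Finset.Ico 1 ⌈u⌉₊, a n * φ ((n : ℝ) / u)
      = ∑ n ∈ Finset.Ico 1 ⌈u⌉₊, a n * openPart φ ((n : ℝ) / u) := by
    refine Finset.sum_congr rfl fun n hn => ?_
    obtain ⟨h1, h2⟩ := Finset.mem_Ico.1 hn
    have h3 : (n : ℝ) / u ∈ Ioo (0 : ℝ) 1 :=
      ⟨div_pos (by exact_mod_cast h1) hu, (div_lt_one hu).2 (Nat.lt_ceil.1 h2)⟩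
    rw [openPart, indicator_of_mem h3]
  rw [h]
  refine hasSum_sum_of_ne_finset_zero fun n hn => ?_
  rw [openPart, indicator_of_notMem, mul_zero]
  rintro ⟨h1, h2⟩
  refine hn (Finset.mem_Ico.2 ⟨?_, Nat.lt_ceil.2 ((div_lt_one hu).1 h2)⟩)
  rcases Nat.eq_zero_or_pos n with rfl | h
  · simp at h1
  · exact h

/-- The combination `∑ cⱼ φ(x / αⱼ)` of dilates of the restriction of `φ` to `(0, 1)`. -/
noncomputable def AdmissibleSequence.dilates (A : AdmissibleSequence m) (φ : ℝ → ℂ) (x : ℝ) : ℂ :=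
  ∑ j, A.c j * openPart φ ((A.α j)⁻¹ * x)

theorem AdmissibleSequence.hasMellin_dilates (A : AdmissibleSequence m) (hφ : IsAuxiliary φ σ₀)
    {s : ℂ} (hs : σ₀ < s.re) :
    HasMellin (A.dilates φ) s (A.dirichletPoly s * mellin φ s) := by
  have h1 := hasMellin_openPart hφ hs
  have h2 : ∀ j, MellinConvergent (fun x => A.c j * openPart φ ((A.α j)⁻¹ * x)) s := fun j => by
    simpa only [smul_eq_mul] using
      ((MellinConvergent.comp_mul_left (inv_pos.2 (A.α_mem j).1)).2 h1.1).const_smul (A.c j)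
  have h3 : ∀ j, mellin (fun x => A.c j * openPart φ ((A.α j)⁻¹ * x)) s
      = A.c j * (A.α j : ℂ) ^ s * mellin φ s := by
    intro j
    have h4 := mellin_const_smul (fun x => openPart φ ((A.α j)⁻¹ * x)) s (A.c j)
    simp only [smul_eq_mul] at h4
    have h5 : ((A.α j : ℂ)).arg ≠ Real.pi := by
      rw [Complex.arg_ofReal_of_nonneg (A.α_mem j).1.le]
      exact Real.pi_pos.ne
    rw [h4, mellin_comp_mul_left _ _ (inv_pos.2 (A.α_mem j).1), h1.2, smul_eq_mul, mul_assoc,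
      Complex.cpow_neg, Complex.ofReal_inv, Complex.inv_cpow _ _ h5, inv_inv]
  have h6 : (fun t : ℝ => (t : ℂ) ^ (s - 1) • A.dilates φ t) = fun t : ℝ =>
      ∑ j, (t : ℂ) ^ (s - 1) • (A.c j * openPart φ ((A.α j)⁻¹ * t)) := by
    funext t
    rw [AdmissibleSequence.dilates, Finset.smul_sum]
  refine ⟨?_, ?_⟩
  · rw [MellinConvergent, h6]
    exact integrable_finsetSum _ fun j _ => h2 j
  · rw [mellin, h6, integral_finsetSum _ fun j _ => h2 j, AdmissibleSequence.dirichletPoly,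
      Finset.sum_mul]
    exact Finset.sum_congr rfl fun j _ => h3 j

theorem sum_psi_eq_neg_tsum (hL : IsContinuedDirichletSeries a L σ₀ m) (hφ : IsAuxiliary φ σ₀)
    (A : AdmissibleSequence m) {t : ℝ} (ht : 0 < t) :
    ∑ j, A.c j * psi a L φ (A.α j / t) = -∑' n : ℕ, a n * A.dilates φ (n * t) := by
  have h1 : HasSum (fun n : ℕ => ∑ j, A.c j * (a n * openPart φ (n / (A.α j / t))))
      (∑ j, A.c j * ∑ n ∈ Finset.Ico 1 ⌈A.α j / t⌉₊, a n * φ ((n : ℝ) / (A.α j / t))) :=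
    hasSum_sum fun j _ => (hasSum_openPart (div_pos (A.α_mem j).1 ht)).mul_left (A.c j)
  have h2 : (fun n : ℕ => ∑ j, A.c j * (a n * openPart φ (n / (A.α j / t))))
      = fun n : ℕ => a n * A.dilates φ (n * t) := by
    funext n
    rw [AdmissibleSequence.dilates, Finset.mul_sum]
    refine Finset.sum_congr rfl fun j _ => ?_
    rw [div_div_eq_mul_div, div_eq_inv_mul]
    ring
  rw [h2] at h1
  rw [h1.tsum_eq]
  simp only [psi, mul_sub, Finset.sum_sub_distrib]
  rw [sum_residue_eq_zero hL hφ A ht, zero_sub]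

theorem IsContinuedDirichletSeries.lseriesSummable (hL : IsContinuedDirichletSeries a L σ₀ m)
    {s : ℂ} (hs : 1 < s.re) : LSeriesSummable a s :=
  LSeriesSummable_of_isBigO_rpow (x := (1 + s.re) / 2) (by linarith)
    (hL.coeff_growth _ (by linarith))

theorem mellin_sum_psi_of_one_lt (hL : IsContinuedDirichletSeries a L σ₀ m)
    (hφ : IsAuxiliary φ σ₀) (A : AdmissibleSequence m) {s : ℂ} (hs : 1 < s.re) :
    mellin (fun t => ∑ j, A.c j * psi a L φ (A.α j / t)) s
      = -(L s * (A.dirichletPoly s * mellin φ s)) := by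
  have hs0 := hL.lt_one.trans hs
  have h1 := A.hasMellin_dilates hφ hs0
  rw [hL.eq_series s hs, ← h1.2, ← mellin_tsum_comp_mul h1.1
    (by simp [AdmissibleSequence.dilates, openPart]) (hL.lseriesSummable hs), mellin, mellin,
    ← integral_neg]
  refine setIntegral_congr_fun measurableSet_Ioi fun t ht => ?_
  simp only [sum_psi_eq_neg_tsum hL hφ A ht, smul_neg]

/-- The factor t^(r - σ₀) shifts the variable; this is the source of the translation of the disc by
r - σ₀. -/
theorem mellin_fA (A : AdmissibleSequence m) (μ : ℂ) :
    mellin (fA a L φ σ₀ r A) μ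
      = mellin (fun t => ∑ j, A.c j * psi a L φ (A.α j / t)) (μ + (r - σ₀)) := by
  rw [← mellin_cpow_smul]
  refine setIntegral_congr_fun measurableSet_Ioi fun t ht => ?_
  have ht : 0 < t := ht
  simp only [fA, smul_eq_mul]
  rw [Complex.ofReal_cpow ht.le, Complex.ofReal_sub]

theorem MemLstar.differentiableAt_mellin {f : ℝ → ℂ} (hf : MemLstar f σ₀) {μ : ℂ}
    (hμ : μ ∈ halfPlane σ₀) : DifferentiableAt ℂ (mellin f) μ := by
  have hμ' : σ₀ < μ.re := hμ
  -- A real point strictly between σ₀ and Re μ: the L² pairing gives convergence there, and the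
  -- support gives holomorphy to its right.
  have h1 : (((σ₀ + μ.re) / 2 : ℝ) : ℂ) ∈ halfPlane σ₀ := by
    change σ₀ < (((σ₀ + μ.re) / 2 : ℝ) : ℂ).re
    rw [Complex.ofReal_re]
    linarith
  exact differentiableAt_mellin_of_support
    (hasMellin_inner_target h1 hf.1.coeFn_toLp hf.2).1 hf.2 (by linarith)

theorem isPreconnected_halfPlane_diff_one (σ : ℝ) : IsPreconnected (halfPlane σ \ {1}) := by
  have hre : ∀ x : ℝ, IsPreconnected {z : ℂ | x < z.re} := fun x =>
    (convex_halfSpace_re_gt x).isPreconnected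
  rcases le_or_gt 1 σ with h | h
  · have h1 : halfPlane σ \ {1} = halfPlane σ := by
      refine sdiff_singleton_eq_self fun h2 => ?_
      have h3 : σ < (1 : ℂ).re := h2
      rw [Complex.one_re] at h3
      linarith
    rw [h1]
    exact hre σ
  have hU : IsPreconnected (halfPlane σ ∩ {z : ℂ | 0 < z.im}) :=
    ((convex_halfSpace_re_gt σ).inter (convex_halfSpace_im_gt 0)).isPreconnected
  have hV : IsPreconnected (halfPlane σ ∩ {z : ℂ | z.im < 0}) :=
    ((convex_halfSpace_re_gt σ).inter (convex_halfSpace_im_lt 0)).isPreconnected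
  have hW : IsPreconnected (halfPlane σ ∩ {z : ℂ | z.re < 1}) :=
    ((convex_halfSpace_re_gt σ).inter (convex_halfSpace_re_lt 1)).isPreconnected
  -- Four convex pieces, Re z > 1, Im z > 0, Im z < 0 and Re z < 1, are glued at 2 + i, 2 - i and (σ
  -- + 1)/2 + i.
  have h1 := (hre 1).union (⟨2, 1⟩ : ℂ) (by simp) (by simp [halfPlane]; linarith) hU
  have h2 := h1.union (⟨2, -1⟩ : ℂ) (by simp) (by simp [halfPlane]; linarith) hV
  have h3 := h2.union (⟨(σ + 1) / 2, 1⟩ : ℂ)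
    (Or.inl (Or.inr (by simp [halfPlane]; linarith)))
    (by simp [halfPlane]; constructor <;> linarith) hW
  convert h3 using 1
  ext z
  have hz : z ∈ ({1} : Set ℂ) ↔ z.re = 1 ∧ z.im = 0 := by
    rw [mem_singleton_iff, Complex.ext_iff, Complex.one_re, Complex.one_im]
  simp only [halfPlane, Set.mem_sdiff, mem_ofPred_eq, hz, mem_union, mem_inter_iff]
  constructor
  · rintro ⟨h4, h5⟩
    rcases lt_trichotomy z.re 1 with h6 | h6 | h6
    · tauto
    · rcases lt_trichotomy z.im 0 with h7 | h7 | h7 <;> tauto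
    · tauto
  · rintro (((h4 | h4) | h4) | h4)
    · exact ⟨h.trans h4, fun h5 => h4.ne' h5.1⟩
    · exact ⟨h4.1, fun h5 => h4.2.ne' h5.2⟩
    · exact ⟨h4.1, fun h5 => h4.2.ne h5.2⟩
    · exact ⟨h4.1, fun h5 => h4.2.ne h5.1⟩

/-- Both sides agree far to the right, and the left side is holomorphic on Re s > r because f_A lies
in L²_*. For m ≥ 1 the identity theorem runs on the half-plane punctured at 1, where the value of L
carries no information. -/
theorem mellin_sum_psi (hL : IsContinuedDirichletSeries a L σ₀ m)
    (hφ : IsAuxiliary φ σ₀) (hr : σ₀ < r) (hψ : MemLp (psi a L φ) 2 (tailMeasure r))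
    (A : AdmissibleSequence m) {s : ℂ} (hs : r < s.re) (hs1 : s ≠ 1 ∨ m = 0) :
    mellin (fun t => ∑ j, A.c j * psi a L φ (A.α j / t)) s
      = -(L s * (A.dirichletPoly s * mellin φ s)) := by
  have hleft : AnalyticOnNhd ℂ (mellin fun t => ∑ j, A.c j * psi a L φ (A.α j / t))
      (halfPlane r) := by
    refine DifferentiableOn.analyticOnNhd (fun z hz => ?_) (isOpen_halfPlane r)
    have h1 : (mellin fun t => ∑ j, A.c j * psi a L φ (A.α j / t))
        = fun z => mellin (fA a L φ σ₀ r A) (z - (r - σ₀)) := by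
      funext z
      rw [mellin_fA, sub_add_cancel]
    have h2 : z - (r - σ₀) ∈ halfPlane σ₀ := by
      have hz : r < z.re := hz
      change σ₀ < (z - (r - σ₀)).re
      simp
      linarith
    rw [h1]
    have h3 := (memLstar_fA hL hφ hψ A).differentiableAt_mellin h2
    exact (DifferentiableAt.comp (f := fun z : ℂ => z - (r - σ₀)) z h3
      (differentiableAt_id.sub_const _)).differentiableWithinAt
  have hsub : halfPlane r ⊆ halfPlane σ₀ := fun z hz => hr.trans hz
  have hright : ∀ z ∈ halfPlane r, AnalyticAt ℂ L z →
      AnalyticAt ℂ (fun s => -(L s * (A.dirichletPoly s * mellin φ s))) z := fun z hz hLz =>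
    (hLz.mul ((A.analyticAt_dirichletPoly z).mul (hφ.analyticOnNhd_mellin z (hsub hz)))).neg
  have hp : 1 < ((max 1 r + 1 : ℝ) : ℂ).re := by
    rw [Complex.ofReal_re]
    linarith [le_max_left 1 r]
  have hpr : ((max 1 r + 1 : ℝ) : ℂ) ∈ halfPlane r := by
    change r < ((max 1 r + 1 : ℝ) : ℂ).re
    rw [Complex.ofReal_re]
    linarith [le_max_right 1 r]
  have hp1 : ((max 1 r + 1 : ℝ) : ℂ) ≠ 1 := fun h => by simp [h] at hp
  have hev : (mellin fun t => ∑ j, A.c j * psi a L φ (A.α j / t))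
      =ᶠ[𝓝 ((max 1 r + 1 : ℝ) : ℂ)] fun s => -(L s * (A.dirichletPoly s * mellin φ s)) := by
    filter_upwards [(isOpen_halfPlane 1).mem_nhds hp] with z hz
    exact mellin_sum_psi_of_one_lt hL hφ A hz
  by_cases hm : m = 0
  · refine hleft.eqOn_of_preconnected_of_eventuallyEq (fun z hz => hright z hz ?_)
      (convex_halfSpace_re_gt r).isPreconnected hpr hev hs
    by_cases h : z = 1
    · exact h ▸ hL.analytic_at_one hm
    · exact hL.analytic_off_one z ⟨hsub hz, h⟩
  · exact (hleft.mono sdiff_subset).eqOn_of_preconnected_of_eventuallyEq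
      (fun z hz => hright z hz.1 (hL.analytic_off_one z ⟨hsub hz.1, hz.2⟩))
      (isPreconnected_halfPlane_diff_one r) ⟨hpr, hp1⟩ hev ⟨hs, hs1.resolve_right hm⟩

/-! ### Reproducing kernels and the distance to K_r -/

/-- The function `t ^ (conj lam - 2 σ₀) χ_{(0,1)}(t)` as an element of `L²_*`. -/
noncomputable def targetLstar {lam : ℂ} (h : lam ∈ halfPlane σ₀) : Lstar σ₀ :=
  ⟨(memLp_target h).toLp (target σ₀ lam), toLp_target_mem h⟩

theorem inner_targetLstar {lam μ : ℂ} (hlam : lam ∈ halfPlane σ₀) (hμ : μ ∈ halfPlane σ₀) :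
    inner ℂ (targetLstar hμ) (targetLstar hlam) = 1 / (μ + conj lam - 2 * (σ₀ : ℂ)) := by
  have h1 : (memLp_target hlam).toLp (target σ₀ lam) =ᵐ[mellinMeasure σ₀]
      (Ioc (0 : ℝ) 1).indicator fun t => (t : ℂ) ^ (conj lam - 2 * (σ₀ : ℂ)) := by
    refine (memLp_target hlam).coeFn_toLp.trans
      ((withDensity_absolutelyContinuous _ _).ae_eq (ae_restrict_of_ae ?_))
    exact indicator_ae_eq_of_ae_eq_set Ioo_ae_eq_Ioc
  have h2 := hasMellin_inner_target hμ h1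
    (Eventually.of_forall fun t ht => indicator_of_notMem (fun h => not_lt.2 h.2 ht) _)
  have h3 : 0 < μ.re + (conj lam - 2 * (σ₀ : ℂ)).re := by
    have h4 : σ₀ < lam.re := hlam
    have h5 : σ₀ < μ.re := hμ
    simp
    linarith
  rw [Submodule.coe_inner, targetLstar, targetLstar, ← h2.2, (hasMellin_cpow_Ioc _ h3).2]
  congr 1
  ring

theorem norm_targetLstar_sq {μ : ℂ} (hμ : μ ∈ halfPlane σ₀) :
    ‖targetLstar hμ‖ ^ 2 = 1 / (2 * (μ.re - σ₀)) := by
  have h1 := inner_self_eq_norm_sq (𝕜 := ℂ) (targetLstar hμ)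
  have h2 : μ + conj μ - 2 * (σ₀ : ℂ) = ((2 * (μ.re - σ₀) : ℝ) : ℂ) := by
    rw [Complex.add_conj]
    push_cast
    ring
  rw [inner_targetLstar hμ hμ, h2, ← Complex.ofReal_one, ← Complex.ofReal_div] at h1
  exact h1.symm

/-- A zero of L at r - σ₀ + μ annihilates the Mellin transform of every f_A at μ, and the orthogonal
complement of a vector is a closed subspace. -/
theorem inner_eq_zero_of_mem_K (hL : IsContinuedDirichletSeries a L σ₀ m)
    (hφ : IsAuxiliary φ σ₀) (hr : σ₀ < r) (hψ : MemLp (psi a L φ) 2 (tailMeasure r))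
    {μ : ℂ} (hμ : μ ∈ halfPlane σ₀) (h1 : (r : ℂ) - σ₀ + μ ≠ 1 ∨ m = 0)
    (h0 : L ((r : ℂ) - σ₀ + μ) = 0) {g : Lstar σ₀} (hg : g ∈ K a L φ σ₀ r m) :
    inner ℂ (targetLstar hμ) g = 0 := by
  have hle : K a L φ σ₀ r m ≤ (ℂ ∙ targetLstar hμ)ᗮ := by
    refine Submodule.topologicalClosure_minimal _ (Submodule.span_le.2 ?_)
      (Submodule.isClosed_orthogonal _)
    rintro f ⟨A, hA⟩
    refine Submodule.mem_orthogonal_singleton_iff_inner_right.2 ?_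
    have hre : r < ((r : ℂ) - σ₀ + μ).re := by
      have h2 : σ₀ < μ.re := hμ
      simp
      linarith
    have h2 := (hasMellin_inner_target hμ hA (memLstar_fA hL hφ hψ A).2).2
    rw [Submodule.coe_inner, targetLstar, ← h2, mellin_fA, add_comm,
      mellin_sum_psi hL hφ hr hψ A hre h1, h0, zero_mul, neg_zero]
  exact Submodule.mem_orthogonal_singleton_iff_inner_right.1 (hle hg)

/-- K_r lies in the hyperplane orthogonal to k_μ, whose distance from k_λ is |⟨k_μ, k_λ⟩| / ‖k_μ‖;
the left side is the square of this. -/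
theorem le_d_sq (hL : IsContinuedDirichletSeries a L σ₀ m)
    (hφ : IsAuxiliary φ σ₀) (hr : σ₀ < r) (hψ : MemLp (psi a L φ) 2 (tailMeasure r))
    {lam μ : ℂ} (hlam : lam ∈ halfPlane σ₀) (hμ : μ ∈ halfPlane σ₀)
    (h1 : (r : ℂ) - σ₀ + μ ≠ 1 ∨ m = 0) (h0 : L ((r : ℂ) - σ₀ + μ) = 0) :
    2 * (μ.re - σ₀) / ‖μ + conj lam - 2 * (σ₀ : ℂ)‖ ^ 2 ≤ d a L φ σ₀ r m hlam ^ 2 := by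
  have hpos : 0 < 2 * (μ.re - σ₀) := by
    have h2 : σ₀ < μ.re := hμ
    linarith
  have hnorm := norm_targetLstar_sq hμ
  have hT : 0 < ‖targetLstar hμ‖ := by
    refine (norm_nonneg _).lt_of_ne fun h => ?_
    rw [← h] at hnorm
    have h3 := one_div_pos.2 hpos
    rw [← hnorm] at h3
    norm_num at h3
  have hd : ‖inner ℂ (targetLstar hμ) (targetLstar hlam)‖ / ‖targetLstar hμ‖
      ≤ d a L φ σ₀ r m hlam := by
    -- The witness 0 shows that K_r is nonempty; `Metric.infDist` to the empty set would be 0.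
    refine (Metric.le_infDist ⟨0, (K a L φ σ₀ r m).zero_mem⟩).2 fun g hg => ?_
    change _ ≤ dist (targetLstar hlam) g
    have h2 : inner ℂ (targetLstar hμ) (targetLstar hlam)
        = inner ℂ (targetLstar hμ) (targetLstar hlam - g) := by
      rw [inner_sub_right, inner_eq_zero_of_mem_K hL hφ hr hψ hμ h1 h0 hg, sub_zero]
    rw [div_le_iff₀ hT, h2, dist_eq_norm, mul_comm]
    exact norm_inner_le_norm (𝕜 := ℂ) (targetLstar hμ) (targetLstar hlam - g)
  refine le_trans (le_of_eq ?_) (pow_le_pow_left₀ (by positivity) hd 2)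
  rw [div_pow, hnorm, inner_targetLstar, norm_div, norm_one, div_pow]
  field_simp

theorem norm_sq_sub_norm_sq (lam μ : ℂ) (σ : ℝ) :
    ‖μ + conj lam - 2 * (σ : ℂ)‖ ^ 2 - ‖μ - lam‖ ^ 2 = 4 * (lam.re - σ) * (μ.re - σ) := by
  rw [Complex.sq_norm, Complex.sq_norm, Complex.normSq_apply, Complex.normSq_apply]
  simp
  ring

theorem norm_sq_lt_of_mem_D {lam μ : ℂ} {hlam : lam ∈ halfPlane σ₀}
    (h : μ ∈ D a L φ σ₀ r m hlam) :
    ‖μ - lam‖ ^ 2 < ‖μ + conj lam - 2 * (σ₀ : ℂ)‖ ^ 2 *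
      (1 - 2 * (lam.re - σ₀) * d a L φ σ₀ r m hlam ^ 2) := by
  have h1 := (Real.lt_sqrt (norm_nonneg _)).1 h.2
  have h2 : 0 < ‖μ + conj lam - 2 * (σ₀ : ℂ)‖ ^ 2 := pow_pos (norm_pos_iff.2 h.1) 2
  rw [norm_div, div_pow, div_lt_iff₀ h2] at h1
  linarith

/-- Membership forces |μ - λ| < |μ + conj λ - 2σ₀|, that is, μ is closer to λ than to its reflection
in the line Re z = σ₀. -/
theorem mem_halfPlane_of_mem_D {lam μ : ℂ} {hlam : lam ∈ halfPlane σ₀}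
    (h : μ ∈ D a L φ σ₀ r m hlam) : μ ∈ halfPlane σ₀ := by
  have h1 := norm_sq_lt_of_mem_D h
  have h2 : 0 < lam.re - σ₀ := sub_pos.2 hlam
  have h3 := norm_sq_sub_norm_sq lam μ σ₀
  have h4 : 0 ≤ ‖μ + conj lam - 2 * (σ₀ : ℂ)‖ ^ 2 *
      (2 * (lam.re - σ₀) * d a L φ σ₀ r m hlam ^ 2) := by positivity
  have h5 : 0 < 4 * (lam.re - σ₀) * (μ.re - σ₀) := by linarith
  exact sub_pos.1 (pos_of_mul_pos_right h5 (by linarith))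

end DirichletZeroFree

theorem mainTheorem1 (a : ℕ → ℂ) (L : ℂ → ℂ) (φ : ℝ → ℂ) (σ₀ r : ℝ) (m : ℕ)
    (hL : DirichletZeroFree.IsContinuedDirichletSeries a L σ₀ m)
    (hφ : DirichletZeroFree.IsAuxiliary φ σ₀) (hr : σ₀ < r)
    (hψ : MemLp (DirichletZeroFree.psi a L φ) 2 (DirichletZeroFree.tailMeasure r)) :
    (∀ A : DirichletZeroFree.AdmissibleSequence m,
      DirichletZeroFree.MemLstar (DirichletZeroFree.fA a L φ σ₀ r A) σ₀) ∧
    ∀ (lam : ℂ) (hlam : lam ∈ DirichletZeroFree.halfPlane σ₀),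
      ∀ μ ∈ DirichletZeroFree.D a L φ σ₀ r m hlam,
        ((r : ℂ) - (σ₀ : ℂ) + μ ≠ 1 ∨ m = 0) → L ((r : ℂ) - (σ₀ : ℂ) + μ) ≠ 0 := by
  refine ⟨DirichletZeroFree.memLstar_fA hL hφ hψ, fun lam hlam μ hμ h1 h0 => ?_⟩
  have hd := DirichletZeroFree.le_d_sq hL hφ hr hψ hlam
    (DirichletZeroFree.mem_halfPlane_of_mem_D hμ) h1 h0
  have hlt := DirichletZeroFree.norm_sq_lt_of_mem_D hμ
  have heq := DirichletZeroFree.norm_sq_sub_norm_sq lam μ σ₀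
  have hpos : 0 < lam.re - σ₀ := sub_pos.2 hlam
  rw [div_le_iff₀ (pow_pos (norm_pos_iff.2 hμ.1) 2)] at hd
  -- Multiplied by 2(Re λ - σ₀), the left side of `hd` becomes the difference of squares in `heq`,
  -- which contradicts `hlt`.
  have hmul := mul_le_mul_of_nonneg_left hd (by linarith : 0 ≤ 2 * (lam.re - σ₀))
  linarith
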